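/- All groups are finite. A group $G$ is supersolvable if it has a series $1=H_0\le H_1\le\cdots\le H_n=G$ of normal subgroups of $G$ with all factors $H_{i+1}/H_i$ cyclic. For a group $T$, let $T^{\mathscr U}$ (the supersolvable residual of $T$) be the intersection of all normal subgroups $N$ of $T$ such that $T/N$ is supersolvable. For a group $G$ put $$N_{\mathscr U}(G)=\bigcap_{T\le G}N_G(T^{\mathscr U}),$$ let $N^0_{\mathscr U}(G)=1$ and $N^{i+1}_{\mathscr U}(G)/N^i_{\mathscr U}(G)=N_{\mathscr U}(G/N^i_{\mathscr U}(G))$ for $i\ge 0$, and let $N^\infty_{\mathscr U}(G)$ be the terminal term of this ascending series. Theorem. Let $G$ be a finite group. If $G=N_{\mathscr U}(G)$, that is, if $T^{\mathscr U}$ is normal in $G$ for every subgroup $T$ of $G$, then $G$ is solvable. Moreover, for every finite group $G$ (whether or not $G=N_{\mathscr U}(G)$), the subgroups $N_{\mathscr U}(G)$ and $N^\infty_{\mathscr U}(G)$ are solvable. -/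

import Mathlib

/-- A (finite) group is supersolvable if it has a series `1 = H₀ ≤ H₁ ≤ ⋯ ≤ Hₙ = G` of subgroups
that are all normal in `G`, such that every factor `Hᵢ₊₁ / Hᵢ` is cyclic. The factor is written as
the image of `Hᵢ₊₁` in `G / Hᵢ`; the terms of the sequence beyond index `n` play no role. -/
def IsSupersolvable (G : Type*) [Group G] : Prop :=
  ∃ (n : ℕ) (H : ℕ → Subgroup G) (_ : ∀ i, (H i).Normal),
    H 0 = ⊥ ∧ H n = ⊤ ∧
      ∀ i < n, H i ≤ H (i + 1) ∧ IsCyclic ((H (i + 1)).map (QuotientGroup.mk' (H i)))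

/-- The supersolvable residual of a group `G`: the intersection of all normal subgroups `N` of `G`
such that `G / N` is supersolvable. -/
def supersolvableResidual (G : Type*) [Group G] : Subgroup G :=
  sInf {N : Subgroup G | ∃ _ : N.Normal, IsSupersolvable (G ⧸ N)}

/-- The supersolvable residual of the group `T`, for a subgroup `T` of `G`, regarded as a subgroup
of `G`. -/
def Subgroup.supersolvableResidual {G : Type*} [Group G] (T : Subgroup G) : Subgroup G :=
  (_root_.supersolvableResidual T).map T.subtype

/-- The weak norm of the subgroup `H` in `G` with respect to the class of supersolvable groups: the
intersection, over all subgroups `T` of `H`, of the normalizers in `G` of the supersolvable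
residuals of the groups `T`. -/
def supersolvableWeakNorm {G : Type*} [Group G] (H : Subgroup G) : Subgroup G :=
  ⨅ (T : Subgroup G) (_ : T ≤ H), Subgroup.normalizer (T.supersolvableResidual : Set G)

/-- The norm of `G` with respect to the class of supersolvable groups: the intersection of the
normalizers of the supersolvable residuals of all subgroups of `G`. -/
def supersolvableNorm (G : Type*) [Group G] : Subgroup G :=
  supersolvableWeakNorm (⊤ : Subgroup G)

theorem mem_supersolvableNorm_iff {G : Type*} [Group G] {x : G} :
    x ∈ supersolvableNorm G ↔
      ∀ T : Subgroup G, x ∈ Subgroup.normalizer (T.supersolvableResidual : Set G) := by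
  simp [supersolvableNorm, supersolvableWeakNorm, Subgroup.mem_iInf]

theorem supersolvableNorm_eq_top_iff {G : Type*} [Group G] :
    supersolvableNorm G = ⊤ ↔ ∀ T : Subgroup G, T.supersolvableResidual.Normal := by
  simp only [Subgroup.eq_top_iff', mem_supersolvableNorm_iff, ← Subgroup.normalizer_eq_top_iff]
  exact forall_comm

/-! The norm is a normal subgroup; this is needed to define the ascending series. -/

theorem IsSupersolvable.of_mulEquiv {A B : Type*} [Group A] [Group B] (e : A ≃* B)
    (h : IsSupersolvable A) : IsSupersolvable B := by
  obtain ⟨n, H, hN, h0, hn, hs⟩ := h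
  have hN' : ∀ i, ((H i).map (e : A →* B)).Normal := fun i =>
    (hN i).map _ e.surjective
  refine ⟨n, fun i => (H i).map (e : A →* B), hN', by simp [h0], ?_, fun i hi => ?_⟩
  · simp only [hn]
    exact Subgroup.map_top_of_surjective _ e.surjective
  · obtain ⟨hle, hc⟩ := hs i hi
    refine ⟨Subgroup.map_mono hle, ?_⟩
    let φ : A ⧸ H i →* B ⧸ (H i).map (e : A →* B) :=
      QuotientGroup.map _ _ (e : A →* B) (Subgroup.le_comap_map _ _)
    have key : ((H (i + 1)).map (e : A →* B)).map (QuotientGroup.mk' ((H i).map (e : A →* B))) =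
        ((H (i + 1)).map (QuotientGroup.mk' (H i))).map φ := by
      rw [Subgroup.map_map, Subgroup.map_map]
      rfl
    have hcyc : IsCyclic (((H (i + 1)).map (QuotientGroup.mk' (H i))).map φ) :=
      isCyclic_of_surjective _ (φ.subgroupMap_surjective _)
    exact key ▸ hcyc

theorem map_supersolvableResidual_le {A B : Type*} [Group A] [Group B] (e : A ≃* B) :
    (supersolvableResidual A).map (e : A →* B) ≤ supersolvableResidual B := by
  rw [Subgroup.map_le_iff_le_comap]
  refine fun a ha => Subgroup.mem_sInf.2 ?_
  rintro N ⟨hN, hs⟩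
  refine Subgroup.mem_sInf.1 ha (N.comap (e : A →* B)) ⟨hN.comap _, ?_⟩
  exact hs.of_mulEquiv
    (QuotientGroup.congr _ _ e (Subgroup.map_comap_eq_self_of_surjective e.surjective N)).symm

theorem Subgroup.map_supersolvableResidual {G : Type*} [Group G] (α : G ≃* G) (T : Subgroup G) :
    T.supersolvableResidual.map (α : G →* G) = (T.map (α : G →* G)).supersolvableResidual := by
  have key : ∀ (β : G ≃* G) (S : Subgroup G),
      S.supersolvableResidual.map (β : G →* G) ≤ (S.map (β : G →* G)).supersolvableResidual := by
    intro β S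
    rintro _ ⟨_, ⟨s, hs, rfl⟩, rfl⟩
    exact ⟨_, map_supersolvableResidual_le (β.subgroupMap S) ⟨s, hs, rfl⟩, rfl⟩
  refine le_antisymm (key α T) ?_
  have h := Subgroup.map_mono (f := (α : G →* G)) (key α.symm (T.map (α : G →* G)))
  have e : ∀ S : Subgroup G, (S.map (α : G →* G)).map (α.symm : G →* G) = S := fun S => by
    rw [Subgroup.map_map]; convert Subgroup.map_id S; ext; simp
  have e' : ∀ S : Subgroup G, (S.map (α.symm : G →* G)).map (α : G →* G) = S := fun S => by
    rw [Subgroup.map_map]; convert Subgroup.map_id S; ext; simp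
  rwa [e, e'] at h

instance supersolvableNorm_normal (G : Type*) [Group G] : (supersolvableNorm G).Normal := by
  refine ⟨fun x hx g => mem_supersolvableNorm_iff.2 fun T => ?_⟩
  have hT : (T.map (MulAut.conj g⁻¹ : G →* G)).map (MulAut.conj g : G →* G) = T := by
    rw [Subgroup.map_map]; convert Subgroup.map_id T; ext; simp [mul_assoc]
  rw [← hT, ← Subgroup.map_supersolvableResidual]
  exact (Subgroup.map_equiv_normalizer_eq _ (MulAut.conj g)).le
    ⟨x, mem_supersolvableNorm_iff.1 hx _, rfl⟩

/-- The ascending series, with the normality of its terms: the `0`-th term is trivial, and the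
`(i + 1)`-st is the preimage in `G` of the norm of the quotient of `G` by the `i`-th. -/
def supersolvableNormSeriesAux (G : Type*) [Group G] : ℕ → {N : Subgroup G // N.Normal}
  | 0 => ⟨⊥, inferInstance⟩
  | i + 1 =>
    let N := supersolvableNormSeriesAux G i
    haveI : N.1.Normal := N.2
    ⟨(supersolvableNorm (G ⧸ N.1)).comap (QuotientGroup.mk' N.1), inferInstance⟩

/-- The `i`-th term `Nⁱ` of the ascending series with `N⁰ = 1` and `Nⁱ⁺¹ / Nⁱ` equal to the norm of
`G / Nⁱ`. -/
def supersolvableNormSeries (G : Type*) [Group G] (i : ℕ) : Subgroup G :=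
  (supersolvableNormSeriesAux G i).1

instance supersolvableNormSeries_normal (G : Type*) [Group G] (i : ℕ) :
    (supersolvableNormSeries G i).Normal :=
  (supersolvableNormSeriesAux G i).2

theorem supersolvableNormSeries_zero (G : Type*) [Group G] : supersolvableNormSeries G 0 = ⊥ :=
  rfl

theorem supersolvableNormSeries_succ (G : Type*) [Group G] (i : ℕ) :
    supersolvableNormSeries G (i + 1) =
      (supersolvableNorm (G ⧸ supersolvableNormSeries G i)).comap
        (QuotientGroup.mk' (supersolvableNormSeries G i)) :=
  rfl

/-- The terminal term `N^∞` of the ascending series, written as the union of the series. -/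
def supersolvableHypernorm (G : Type*) [Group G] : Subgroup G :=
  ⨆ i, supersolvableNormSeries G i

theorem supersolvableNormSeries_monotone (G : Type*) [Group G] :
    Monotone (supersolvableNormSeries G) := by
  refine monotone_nat_of_le_succ fun i x hx => ?_
  rw [supersolvableNormSeries_succ, Subgroup.mem_comap, QuotientGroup.mk'_apply,
    (QuotientGroup.eq_one_iff x).2 hx]
  exact one_mem _

/-- In a finite group the series becomes stationary, at `N^∞`. -/
theorem supersolvableNormSeries_eventually_eq (G : Type*) [Group G] [Finite G] :
    ∃ k, ∀ m, k ≤ m → supersolvableNormSeries G m = supersolvableHypernorm G := by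
  obtain ⟨k, hk⟩ := WellFoundedGT.monotone_chain_condition
    ⟨supersolvableNormSeries G, supersolvableNormSeries_monotone G⟩
  have hk' : ∀ m, k ≤ m → supersolvableNormSeries G k = supersolvableNormSeries G m := hk
  refine ⟨k, fun m hm => le_antisymm (le_iSup (supersolvableNormSeries G) m) ?_⟩
  refine iSup_le fun i => ?_
  rw [← hk' m hm, hk' (max i k) (le_max_right _ _)]
  exact supersolvableNormSeries_monotone G (le_max_left _ _)

/-! In a minimal counterexample `G`, normality of all the residuals passes to normal subgroups and
quotients, so `G` is simple and perfect. For proper `T` the residual is then a proper normal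
subgroup of `G`, hence trivial, so every proper subgroup is supersolvable.

Let `p` be the smallest prime dividing the order of `G`. A supersolvable group with no smaller prime
divisor is `p`-nilpotent (`IsSupersolvable.pRegularClosed`): peel off normal subgroups of prime
order, those of order `p` being central. Normalizers of nontrivial `p`-subgroups are proper, hence
`p`-nilpotent, so a Sylow `p`-subgroup `P` controls its own fusion. By the focal subgroup theorem `P
∩ G' = P' < P`, so `G` is not perfect (`Sylow.commutator_ne_top`), a contradiction.

The norm satisfies the hypothesis as a group in its own right, and each term of the ascending series
is an extension of solvable groups. -/

/-- A group has the `p`-regular closure property if the product of two elements of order prime to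
`p` has order prime to `p`. For finite groups this is equivalent to `p`-nilpotency. -/
def PRegularClosed (p : ℕ) (G : Type*) [Group G] : Prop :=
  ∀ x y : G, p.Coprime (orderOf x) → p.Coprime (orderOf y) → p.Coprime (orderOf (x * y))

/-! ### The normal `p`-complement of a `p`-nilpotent group. -/

namespace PRegularClosed

variable {p : ℕ} {G : Type*} [Group G]

/-- The subgroup of elements of order prime to `p`. -/
def regularSubgroup (hG : PRegularClosed p G) : Subgroup G where
  carrier := {x | p.Coprime (orderOf x)}
  mul_mem' := hG _ _
  one_mem' := by simp
  inv_mem' := by simp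

theorem mem_regularSubgroup (hG : PRegularClosed p G) {x : G} :
    x ∈ hG.regularSubgroup ↔ p.Coprime (orderOf x) :=
  Iff.rfl

instance regularSubgroup_normal (hG : PRegularClosed p G) : hG.regularSubgroup.Normal :=
  ⟨fun n hn g => by
    rw [mem_regularSubgroup] at hn ⊢
    rw [← MulAut.conj_apply, MulEquiv.orderOf_eq]
    exact hn⟩

theorem coprime_card_regularSubgroup [Finite G] [hp : Fact p.Prime] (hG : PRegularClosed p G) :
    p.Coprime (Nat.card hG.regularSubgroup) := by
  rw [hp.out.coprime_iff_not_dvd]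
  intro h
  obtain ⟨x, hx⟩ := exists_prime_orderOf_dvd_card' p h
  have hc := hG.mem_regularSubgroup.1 x.2
  rw [Subgroup.orderOf_coe, hx, Nat.coprime_self] at hc
  exact hp.out.one_lt.ne' hc

/-- Raising an element to the `p`-part of its order leaves an element of order prime to `p`. -/
theorem isPGroup_quotient_regularSubgroup [Finite G] [hp : Fact p.Prime]
    (hG : PRegularClosed p G) : IsPGroup p (G ⧸ hG.regularSubgroup) := by
  intro q
  obtain ⟨x, rfl⟩ := QuotientGroup.mk_surjective q
  obtain ⟨k, m, hm, hk⟩ := Nat.exists_eq_pow_mul_and_not_dvd (orderOf_pos x).ne' p hp.out.ne_one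
  refine ⟨k, ?_⟩
  rw [← QuotientGroup.mk_pow, QuotientGroup.eq_one_iff, mem_regularSubgroup]
  rw [← hp.out.coprime_iff_not_dvd] at hm
  refine hm.coprime_dvd_right (orderOf_dvd_of_pow_eq_one ?_)
  rw [← pow_mul, ← hk, pow_orderOf_eq_one]

theorem regularSubgroup_sup_sylow [Finite G] [hp : Fact p.Prime] (hG : PRegularClosed p G)
    (S : Sylow p G) : hG.regularSubgroup ⊔ S = ⊤ := by
  rw [← Subgroup.index_eq_one]
  obtain ⟨n, hn⟩ := hG.isPGroup_quotient_regularSubgroup.exists_card_eq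
  refine Nat.Coprime.eq_one_of_dvd (m := (S : Subgroup G).index) (Nat.Coprime.coprime_dvd_left
    (Subgroup.index_dvd_of_le (H := hG.regularSubgroup) le_sup_left) ?_)
    (Subgroup.index_dvd_of_le (H := (S : Subgroup G)) (K := hG.regularSubgroup ⊔ S) le_sup_right)
  rw [Subgroup.index_eq_card, hn]
  exact ((hp.out.coprime_iff_not_dvd).2 S.not_dvd_index).pow_left n

/-- A conjugating element factors as `k * s` with `s` in `S`, and `s` fixes `S`. -/
theorem exists_regular_smul_eq [Finite G] [hp : Fact p.Prime] (hG : PRegularClosed p G)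
    (S T : Sylow p G) : ∃ k ∈ hG.regularSubgroup, k • S = T := by
  obtain ⟨n, hn⟩ := MulAction.exists_smul_eq G S T
  have hmem : n ∈ hG.regularSubgroup ⊔ S := by simp [hG.regularSubgroup_sup_sylow S]
  obtain ⟨k, hk, s, hs, rfl⟩ := Subgroup.mem_sup_of_normal_left.1 hmem
  refine ⟨k, hk, ?_⟩
  rwa [mul_smul, Sylow.smul_eq_iff_mem_normalizer.2 (Subgroup.le_normalizer hs)] at hn

/-- Elements of order prime to `p` centralize every normal `p`-subgroup. -/
theorem commute_of_mem_regularSubgroup [Finite G] [hp : Fact p.Prime] (hG : PRegularClosed p G)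
    {D : Subgroup G} [D.Normal] (hD : IsPGroup p D) {k d : G} (hk : k ∈ hG.regularSubgroup)
    (hd : d ∈ D) : Commute k d := by
  have hdisj : Disjoint hG.regularSubgroup D := by
    refine Subgroup.disjoint_of_coprime_natCard ?_
    obtain ⟨n, hn⟩ := hD.exists_card_eq
    rw [hn]
    exact (hG.coprime_card_regularSubgroup.pow_left n).symm
  exact Subgroup.commute_of_normal_of_disjoint _ _ inferInstance inferInstance hdisj k d hk hd

end PRegularClosed

/-! ### Control of fusion and the focal subgroup. -/

section Fusion

theorem Sylow.ext_of_le {p : ℕ} {G : Type*} [Group G] {P Q : Sylow p G} (h : (P : Subgroup G) ≤ Q) : P = Q :=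
  Sylow.ext (P.is_maximal' Q.2 h).symm

open scoped Pointwise commutatorElement

variable {p : ℕ} [hp : Fact p.Prime] {G : Type*} [Group G] [Finite G]

theorem IsPGroup.lt_normalizer_inf {P D : Subgroup G} (hP : IsPGroup p P) (hD : D < P) :
    D < Subgroup.normalizer (D : Set G) ⊓ P := by
  have := hP.isNilpotent
  have hlt : D.subgroupOf P < ⊤ := by
    rw [lt_top_iff_ne_top, Ne, Subgroup.subgroupOf_eq_top]
    exact hD.not_ge
  obtain ⟨-, x, hx, hxD⟩ := SetLike.lt_iff_le_and_exists.1
    (Group.normalizerCondition_of_isNilpotent (D.subgroupOf P) hlt)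
  refine SetLike.lt_iff_le_and_exists.2
    ⟨le_inf Subgroup.le_normalizer hD.le, (x : G), Subgroup.mem_inf.2 ⟨?_, x.2⟩, hxD⟩
  rw [Subgroup.mem_normalizer_iff]
  intro d
  constructor
  · intro hd
    exact (Subgroup.mem_normalizer_iff.1 hx ⟨d, hD.le hd⟩).1 hd
  · intro hd
    have hdP : d ∈ P := by
      have := P.mul_mem (P.mul_mem (P.inv_mem x.2) (hD.le hd)) x.2
      simpa [mul_assoc] using this
    exact (Subgroup.mem_normalizer_iff.1 hx ⟨d, hdP⟩).2 hd

/-- If the normalizers of the nontrivial `p`-subgroups are `p`-nilpotent, two Sylow `p`-subgroups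
are conjugate by an element centralizing any given subgroup of their intersection. -/
theorem Sylow.exists_mem_centralizer_smul_eq
    (hloc : ∀ D : Subgroup G, IsPGroup p D → D ≠ ⊥ →
      PRegularClosed p (Subgroup.normalizer (D : Set G)))
    (D : Subgroup G) (P Q : Sylow p G) (hDP : D ≤ P) (hDQ : D ≤ Q) :
    ∃ x ∈ Subgroup.centralizer (D : Set G), x • P = Q := by
  -- Downward induction: the claim is assumed for all subgroups strictly larger than `D`.
  induction D using WellFoundedGT.induction generalizing P Q with
  | ind D ih =>
  by_cases hbot : D = ⊥
  · obtain ⟨x, hx⟩ := MulAction.exists_smul_eq G P Q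
    exact ⟨x, by simp [hbot, Subgroup.mem_centralizer_iff], hx⟩
  rcases hDP.eq_or_lt with rfl | hltP
  · exact ⟨1, one_mem _, by rw [one_smul]; exact Sylow.ext_of_le hDQ⟩
  rcases hDQ.eq_or_lt with rfl | hltQ
  · exact ⟨1, one_mem _, by rw [one_smul]; exact (Sylow.ext_of_le hDP).symm⟩
  have hDp : IsPGroup p D := P.2.to_le hDP
  set N := Subgroup.normalizer (D : Set G) with hN
  have hNp : PRegularClosed p N := hloc D hDp hbot
  have hP1 : D < N ⊓ P := P.2.lt_normalizer_inf hltP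
  have hQ1 : D < N ⊓ Q := Q.2.lt_normalizer_inf hltQ
  -- `P` and `Q` are linked through Sylow subgroups `R` and `k • R`, where `k` has order prime to
  -- `p` in `N` and so centralizes `D`. Both `P ∩ R` and `(k • R) ∩ Q` exceed `D`, because
  -- normalizers grow in `p`-groups, so induction applies to each pair.
  obtain ⟨S, hS⟩ := IsPGroup.exists_le_sylow
    (P := (N ⊓ P).subgroupOf N) (P.2.to_le inf_le_right |>.comap_subtype)
  obtain ⟨T, hT⟩ := IsPGroup.exists_le_sylow
    (P := (N ⊓ Q).subgroupOf N) (Q.2.to_le inf_le_right |>.comap_subtype)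
  obtain ⟨k, hk, rfl⟩ := hNp.exists_regular_smul_eq S T
  obtain ⟨R, hR⟩ := IsPGroup.exists_le_sylow (S.2.map N.subtype)
  have hPR : N ⊓ P ≤ R := fun x hx => hR ⟨⟨x, hx.1⟩, hS hx, rfl⟩
  have hQR : N ⊓ Q ≤ ((k : G) • R : Sylow p G) := fun x hx => by
    have hmem := hT (show (⟨x, hx.1⟩ : N) ∈ (N ⊓ Q).subgroupOf N from hx)
    rw [Sylow.coe_subgroup_smul, Subgroup.mem_pointwise_smul_iff_inv_smul_mem] at hmem ⊢
    exact hR ⟨_, hmem, by simp⟩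
  obtain ⟨x, hx, rfl⟩ := ih _ hP1 P R inf_le_right hPR
  obtain ⟨y, hy, rfl⟩ := ih _ hQ1 _ Q hQR inf_le_right
  have hkD : (k : G) ∈ Subgroup.centralizer (D : Set G) := by
    rw [Subgroup.mem_centralizer_iff]
    intro d hd
    have : IsPGroup p (D.subgroupOf N) := hDp.comap_subtype
    have hc := hNp.commute_of_mem_regularSubgroup this hk
      (d := ⟨d, Subgroup.le_normalizer hd⟩) hd
    exact (congrArg Subtype.val hc.eq).symm
  have hle {E : Subgroup G} (hE : D < E) :
      Subgroup.centralizer (E : Set G) ≤ Subgroup.centralizer (D : Set G) :=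
    Subgroup.centralizer_le hE.le
  exact ⟨y * (k * x), mul_mem (hle hQ1 hy) (mul_mem hkD (hle hP1 hx)), by
    rw [mul_smul, mul_smul]⟩

/-- If the normalizers of the nontrivial `p`-subgroups are `p`-nilpotent, a Sylow `p`-subgroup
controls its own fusion. -/
theorem Sylow.exists_mem_conj_eq
    (hloc : ∀ D : Subgroup G, IsPGroup p D → D ≠ ⊥ →
      PRegularClosed p (Subgroup.normalizer (D : Set G)))
    (P : Sylow p G) {x g : G} (hx : x ∈ P) (hgx : g * x * g⁻¹ ∈ P) :
    ∃ h ∈ P, g * x * g⁻¹ = h * x * h⁻¹ := by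
  by_cases hbot : (P : Subgroup G) = ⊥
  · have hx1 : x = 1 := by
      rw [← Subgroup.mem_bot, ← hbot]; exact hx
    exact ⟨1, one_mem _, by simp [hx1]⟩
  have hz : Subgroup.zpowers (g * x * g⁻¹) ≤ P := (Subgroup.zpowers_le).2 hgx
  have hz' : Subgroup.zpowers (g * x * g⁻¹) ≤ (g • P : Sylow p G) := by
    rw [Subgroup.zpowers_le, Sylow.coe_subgroup_smul,
      Subgroup.mem_pointwise_smul_iff_inv_smul_mem]
    simpa [mul_assoc] using show x ∈ (P : Subgroup G) from hx
  -- As `c` centralizes `g * x * g⁻¹` and `c * g` normalizes `P`, the fusion of `x` is realized in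
  -- the normalizer of `P`. There `c * g = r * s` with `s` in `P` and `r` centralizing `P`.
  obtain ⟨c, hc, hcP⟩ := Sylow.exists_mem_centralizer_smul_eq hloc _ _ _ hz' hz
  rw [smul_smul, Sylow.smul_eq_iff_mem_normalizer] at hcP
  have hNp := hloc P P.2 hbot
  have hn : (⟨c * g, hcP⟩ : Subgroup.normalizer (P : Set G)) ∈
      hNp.regularSubgroup ⊔ (P.subtype Subgroup.le_normalizer : Subgroup _) := by
    rw [hNp.regularSubgroup_sup_sylow]; trivial
  obtain ⟨r, hr, s, hs, hrs⟩ := Subgroup.mem_sup_of_normal_left.1 hn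
  have hrs' : (r : G) * s = c * g := congrArg Subtype.val hrs
  have hsP : (s : G) ∈ (P : Subgroup G) := hs
  have hsx : (s : G) * x * (s : G)⁻¹ ∈ (P : Subgroup G) := mul_mem (mul_mem hsP hx) (inv_mem hsP)
  have hPN : IsPGroup p ((P : Subgroup G).subgroupOf (Subgroup.normalizer (P : Set G))) :=
    P.2.comap_subtype
  have : ((P : Subgroup G).subgroupOf (Subgroup.normalizer (P : Set G))).Normal :=
    Subgroup.normal_in_normalizer (H := (P : Subgroup G))
  have hrx : (r : G) * (s * x * (s : G)⁻¹) = s * x * (s : G)⁻¹ * r := congrArg Subtype.val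
    (hNp.commute_of_mem_regularSubgroup hPN hr (d := ⟨_, Subgroup.le_normalizer hsx⟩) hsx).eq
  have hcx := Subgroup.mem_centralizer_iff.1 hc _ (Subgroup.mem_zpowers _)
  refine ⟨s, hsP, ?_⟩
  calc g * x * g⁻¹ = c * (g * x * g⁻¹) * c⁻¹ := by rw [← hcx]; group
    _ = (c * g) * x * (c * g)⁻¹ := by group
    _ = r * (s * x * (s : G)⁻¹) * (r : G)⁻¹ := by rw [← hrs']; group
    _ = s * x * (s : G)⁻¹ := by rw [hrx]; group

/-- A special case of **Frobenius' normal `p`-complement theorem**. -/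
theorem Sylow.commutator_ne_top
    (hloc : ∀ D : Subgroup G, IsPGroup p D → D ≠ ⊥ →
      PRegularClosed p (Subgroup.normalizer (D : Set G)))
    (hpG : p ∣ Nat.card G) : commutator G ≠ ⊤ := by
  intro htop
  obtain ⟨P⟩ : Nonempty (Sylow p G) := inferInstance
  have hfoc := Subgroup.commutator_inf_eq_focalSubgroup P
  rw [htop, top_inf_eq] at hfoc
  have hle : (P : Subgroup G) ≤ ⁅(P : Subgroup G), (P : Subgroup G)⁆ := by
    conv_lhs => rw [hfoc]
    rw [Subgroup.focalSubgroup_def, Subgroup.closure_le]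
    rintro _ ⟨hg, x, hx, u, rfl⟩
    -- With `⁅x, u⁆ = x * (u * x⁻¹ * u⁻¹)`, it is the fusion of `x⁻¹` that allows `u` to be replaced
    -- by an element of `P`.
    have hu : u * x⁻¹ * u⁻¹ ∈ (P : Subgroup G) := by
      have := mul_mem (inv_mem hx) hg
      simpa [commutatorElement_def, mul_assoc] using this
    obtain ⟨h, hh, he⟩ := P.exists_mem_conj_eq hloc (inv_mem hx) hu
    have : ⁅x, u⁆ = ⁅x, h⁆ := by
      simpa [commutatorElement_def, mul_assoc] using he
    rw [this]
    exact Subgroup.commutator_mem_commutator hx hh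
  have := P.2.isNilpotent
  have hne : (P : Subgroup G) ≠ ⊥ := P.ne_bot_of_dvd_card hpG
  have : Nontrivial P := (Subgroup.nontrivial_iff_ne_bot _).2 hne
  refine (Group.IsSolvable.commutator_lt_top_of_nontrivial P).ne
    (Subgroup.map_injective (P : Subgroup G).subtype_injective ?_)
  rw [Subgroup.map_subtype_commutator, ← MonoidHom.range_eq_map, Subgroup.range_subtype]
  exact le_antisymm (Subgroup.commutator_le_self _) hle

end Fusion

/-! ### Supersolvability as chains of cyclic steps. -/

/-- `H` and `H'` are normal subgroups, and `H'` is generated by `H` and one element. -/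
def IsCyclicStep {G : Type*} [Group G] (H H' : Subgroup G) : Prop :=
  H.Normal ∧ H'.Normal ∧ ∃ g, H' = H ⊔ Subgroup.zpowers g

section Chains

open Relation

variable {G G' : Type*} [Group G] [Group G']

theorem isCyclic_map_mk'_iff {H H' : Subgroup G} [H.Normal] (hle : H ≤ H') :
    IsCyclic (H'.map (QuotientGroup.mk' H)) ↔ ∃ g, H' = H ⊔ Subgroup.zpowers g := by
  have hcomap : (H'.map (QuotientGroup.mk' H)).comap (QuotientGroup.mk' H) = H' := by
    rw [Subgroup.comap_map_eq, QuotientGroup.ker_mk', sup_eq_left.2 hle]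
  rw [Subgroup.isCyclic_iff_exists_zpowers_eq_top]
  constructor
  · rintro ⟨q, hq⟩
    obtain ⟨g, rfl⟩ := QuotientGroup.mk'_surjective H q
    refine ⟨g, ?_⟩
    rw [← hcomap, ← hq, ← MonoidHom.map_zpowers, Subgroup.comap_map_eq, QuotientGroup.ker_mk',
      sup_comm]
  · rintro ⟨g, rfl⟩
    refine ⟨QuotientGroup.mk' H g, ?_⟩
    rw [Subgroup.map_sup, MonoidHom.map_zpowers, QuotientGroup.map_mk'_self, bot_sup_eq]

/-- In this form chains can be concatenated and carried along `map`, `comap` and intersection. -/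
theorem isSupersolvable_iff_reflTransGen :
    IsSupersolvable G ↔ ReflTransGen (IsCyclicStep (G := G)) ⊥ ⊤ := by
  constructor
  · rintro ⟨n, H, hN, h0, hn, hs⟩
    have key : ∀ i ≤ n, ReflTransGen (IsCyclicStep (G := G)) ⊥ (H i) := by
      intro i
      induction i with
      | zero => intro _; rw [h0]
      | succ i ih =>
        intro hi
        obtain ⟨hle, hc⟩ := hs i hi
        exact (ih (by omega)).tail ⟨hN i, hN (i + 1), (isCyclic_map_mk'_iff hle).1 hc⟩
    exact hn ▸ key n le_rfl
  · intro h
    suffices key : ∀ K : Subgroup G, ReflTransGen (IsCyclicStep (G := G)) ⊥ K →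
        ∃ (n : ℕ) (H : ℕ → Subgroup G) (_ : ∀ i, (H i).Normal), H 0 = ⊥ ∧ H n = K ∧
          ∀ i < n, H i ≤ H (i + 1) ∧ IsCyclic ((H (i + 1)).map (QuotientGroup.mk' (H i))) from
      key ⊤ h
    intro K hK
    induction hK with
    | refl => exact ⟨0, fun _ => ⊥, fun _ => inferInstance, rfl, rfl, by simp⟩
    | @tail A B _ hAB ih =>
      obtain ⟨n, H, hN, h0, rfl, hs⟩ := ih
      obtain ⟨-, hB, hg⟩ := hAB
      have hle : H n ≤ B := by obtain ⟨g, rfl⟩ := hg; exact le_sup_left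
      refine ⟨n + 1, fun i => if i ≤ n then H i else B, fun i => ?_, by simpa using h0, by simp, ?_⟩
      · dsimp only
        split_ifs
        exacts [hN i, hB]
      · intro i hi
        rcases (Nat.lt_succ_iff.1 hi).lt_or_eq with hi | rfl
        · have h1 : (if i ≤ n then H i else B) = H i := if_pos hi.le
          have h2 : (if i + 1 ≤ n then H (i + 1) else B) = H (i + 1) := if_pos hi
          simp only [h2]
          convert hs i hi
        · have h1 : (if i ≤ i then H i else B) = H i := if_pos le_rfl
          have h2 : (if i + 1 ≤ i then H (i + 1) else B) = B := if_neg (by omega)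
          simp only [h2]
          have := (isCyclic_map_mk'_iff hle).2 hg
          convert And.intro hle this

theorem IsCyclicStep.map {f : G →* G'} (hf : Function.Surjective f) {H H' : Subgroup G}
    (h : IsCyclicStep H H') : IsCyclicStep (H.map f) (H'.map f) := by
  obtain ⟨h1, h2, g, rfl⟩ := h
  exact ⟨h1.map f hf, h2.map f hf, f g, by rw [Subgroup.map_sup, MonoidHom.map_zpowers]⟩

theorem IsCyclicStep.comap {f : G →* G'} (hf : Function.Surjective f) {H H' : Subgroup G'}
    (h : IsCyclicStep H H') : IsCyclicStep (H.comap f) (H'.comap f) := by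
  obtain ⟨h1, h2, g, rfl⟩ := h
  obtain ⟨g, rfl⟩ := hf g
  refine ⟨h1.comap f, h2.comap f, g, ?_⟩
  rw [← Subgroup.comap_sup_eq _ _ _ hf, ← MonoidHom.map_zpowers, Subgroup.comap_map_eq,
    ← sup_assoc, sup_right_comm, sup_eq_left.2 (f.ker_le_comap H)]

/-- The image of `A ⊓ H'` modulo `H` is a subgroup of a cyclic group; a generator of it lifts to `A
⊓ H'`. -/
theorem IsCyclicStep.inf_left (A : Subgroup G) [hA : A.Normal] {H H' : Subgroup G}
    (h : IsCyclicStep H H') : IsCyclicStep (A ⊓ H) (A ⊓ H') := by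
  obtain ⟨h1, h2, hg⟩ := h
  have hle : H ≤ H' := by obtain ⟨g, rfl⟩ := hg; exact le_sup_left
  refine ⟨inferInstance, inferInstance, ?_⟩
  have := (isCyclic_map_mk'_iff hle).2 hg
  have hcyc : IsCyclic ((A ⊓ H').map (QuotientGroup.mk' H)) :=
    Subgroup.isCyclic_of_le (Subgroup.map_mono inf_le_right)
  obtain ⟨q, hq⟩ := (Subgroup.isCyclic_iff_exists_zpowers_eq_top _).1 hcyc
  obtain ⟨a, ha, rfl⟩ : q ∈ (A ⊓ H').map (QuotientGroup.mk' H) :=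
    hq ▸ Subgroup.mem_zpowers q
  refine ⟨a, le_antisymm (fun x hx => ?_) (sup_le (inf_le_inf_left A hle) ?_)⟩
  · have hx' := Subgroup.mem_map_of_mem (QuotientGroup.mk' H) hx
    rw [← hq] at hx'
    obtain ⟨k, hk⟩ := Subgroup.mem_zpowers_iff.1 hx'
    have hxk : x * (a ^ k)⁻¹ ∈ A ⊓ H := by
      refine ⟨A.mul_mem hx.1 (A.inv_mem (A.zpow_mem ha.1 k)), ?_⟩
      rw [← map_zpow] at hk
      have h1 : QuotientGroup.mk' H (x * (a ^ k)⁻¹) = 1 := by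
        rw [map_mul, map_inv, hk, mul_inv_cancel]
      exact (QuotientGroup.eq_one_iff _).1 h1
    have := Subgroup.mul_mem_sup hxk (Subgroup.zpow_mem_zpowers a k)
    rwa [inv_mul_cancel_right] at this
  · simpa using ha

theorem IsSupersolvable.of_surjective (h : IsSupersolvable G) {f : G →* G'}
    (hf : Function.Surjective f) : IsSupersolvable G' := by
  rw [isSupersolvable_iff_reflTransGen] at h ⊢
  have := h.lift (Subgroup.map f) fun _ _ => IsCyclicStep.map hf
  rwa [Function.onFun, Subgroup.map_bot, Subgroup.map_top_of_surjective f hf] at this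

theorem isSupersolvable_quotient_iff (N : Subgroup G) [N.Normal] :
    IsSupersolvable (G ⧸ N) ↔ ReflTransGen (IsCyclicStep (G := G)) N ⊤ := by
  rw [isSupersolvable_iff_reflTransGen]
  have hs := QuotientGroup.mk'_surjective N
  constructor <;> intro h
  · have := h.lift (Subgroup.comap (QuotientGroup.mk' N)) fun _ _ => IsCyclicStep.comap hs
    rwa [Function.onFun, MonoidHom.comap_bot, QuotientGroup.ker_mk', Subgroup.comap_top] at this
  · have := h.lift (Subgroup.map (QuotientGroup.mk' N)) fun _ _ => IsCyclicStep.map hs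
    rwa [Function.onFun, Subgroup.map_top_of_surjective _ hs, QuotientGroup.map_mk'_self] at this

/-- Intersecting a chain from `B` to `⊤` with `A` gives a chain from `A ⊓ B` to `A`, which a chain
from `A` to `⊤` continues. -/
theorem IsSupersolvable.quotient_inf {A B : Subgroup G} [A.Normal] [B.Normal]
    (hA : IsSupersolvable (G ⧸ A)) (hB : IsSupersolvable (G ⧸ B)) :
    IsSupersolvable (G ⧸ (A ⊓ B)) := by
  rw [isSupersolvable_quotient_iff] at *
  have := hB.lift (A ⊓ ·) fun _ _ => IsCyclicStep.inf_left A
  rw [Function.onFun, inf_top_eq] at this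
  exact this.trans hA

theorem isSupersolvable_of_subsingleton [Subsingleton G] : IsSupersolvable G := by
  rw [isSupersolvable_iff_reflTransGen, Subsingleton.elim (⊥ : Subgroup G) ⊤]

/-- A nontrivial finite supersolvable group has a normal subgroup of prime order. -/
theorem IsSupersolvable.exists_normal_card_prime [Finite G] [Nontrivial G]
    (h : IsSupersolvable G) : ∃ A : Subgroup G, A.Normal ∧ (Nat.card A).Prime := by
  rw [isSupersolvable_iff_reflTransGen] at h
  obtain ⟨H, hH, hne⟩ : ∃ H : Subgroup G, IsCyclicStep ⊥ H ∧ H ≠ ⊥ := by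
    have key : ∀ K : Subgroup G, ReflTransGen (IsCyclicStep (G := G)) ⊥ K → K ≠ ⊥ →
        ∃ H : Subgroup G, IsCyclicStep ⊥ H ∧ H ≠ ⊥ := by
      intro K hK
      induction hK with
      | refl => exact fun h => (h rfl).elim
      | @tail A B _ hAB ih =>
        intro hB
        by_cases hA : A = ⊥
        · exact ⟨B, hA ▸ hAB, hB⟩
        · exact ih hA
    exact key ⊤ h top_ne_bot
  obtain ⟨-, hN, g, rfl⟩ := hH
  rw [bot_sup_eq] at hN hne
  have hg : orderOf g ≠ 1 := by
    rwa [Ne, orderOf_eq_one_iff, ← Subgroup.zpowers_eq_bot]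
  have hp := Nat.minFac_prime hg
  -- The subgroup of prime order in the normal cyclic group generated by `g` is characteristic
  -- there, hence normal.
  refine ⟨Subgroup.zpowers (g ^ (orderOf g / (orderOf g).minFac)), ⟨?_⟩, ?_⟩
  · rintro _ ⟨k, rfl⟩ x
    obtain ⟨j, hj⟩ := Subgroup.mem_zpowers_iff.1 (hN.conj_mem g (Subgroup.mem_zpowers g) x)
    refine Subgroup.mem_zpowers_iff.2 ⟨j * k, ?_⟩
    simp only
    rw [← conj_zpow, ← conj_pow, ← hj]
    simp only [← zpow_natCast, ← zpow_mul]
    ring_nf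
  · rw [Nat.card_zpowers, orderOf_pow_orderOf_div (orderOf_pos g).ne' (Nat.minFac_dvd _)]
    exact hp

end Chains

universe u

/-! ### `p`-nilpotency of supersolvable groups for the smallest prime. -/

section Nilpotency

/-- If `m` is the order of `x * y` modulo `A`, then `(x * y) ^ m` lies in `A`, so the order of `x *
y` divides `m * Nat.card A`. -/
theorem PRegularClosed.of_quotient_of_coprime {p : ℕ} {G : Type*} [Group G] (A : Subgroup G) [A.Normal]
    (hA : p.Coprime (Nat.card A)) (h : PRegularClosed p (G ⧸ A)) : PRegularClosed p G := by
  intro x y hx hy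
  have hxy := h x y (hx.coprime_dvd_right (orderOf_map_dvd (QuotientGroup.mk' A) x))
    (hy.coprime_dvd_right (orderOf_map_dvd (QuotientGroup.mk' A) y))
  refine (hxy.mul_right hA).coprime_dvd_right (orderOf_dvd_of_pow_eq_one ?_)
  rw [pow_mul]
  refine orderOf_dvd_iff_pow_eq_one.1 (Subgroup.orderOf_dvd_natCard A ?_)
  rw [← QuotientGroup.eq_one_iff, QuotientGroup.mk_pow, QuotientGroup.mk_mul, pow_orderOf_eq_one]

variable {p : ℕ} [hp : Fact p.Prime] {G : Type u} [Group G] [Finite G]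

/-- If `p` is at most every prime divisor of the order of `G`, a normal subgroup of order `p` is
central. -/
theorem Subgroup.le_center_of_card_eq_of_le (hmin : ∀ q : ℕ, q.Prime → q ∣ Nat.card G → p ≤ q)
    (A : Subgroup G) [A.Normal] (hA : Nat.card A = p) : A ≤ Subgroup.center G := by
  have : IsCyclic A := isCyclic_of_prime_card hA
  have hcard : Nat.card (MulAut A) = p - 1 := by
    rw [IsCyclic.card_mulAut, hA, Nat.totient_prime hp.out]
  -- A nontrivial automorphism induced by conjugation would have order with a prime factor dividing
  -- both the order of `G` and `p - 1`, hence below `p`.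
  have htriv : ∀ g : G, MulAut.conjNormal (H := A) g = 1 := by
    intro g
    rw [← orderOf_eq_one_iff]
    by_contra hne
    have hq := Nat.minFac_prime hne
    have hle := hmin _ hq (((Nat.minFac_dvd _).trans (orderOf_map_dvd _ g)).trans
      (_root_.orderOf_dvd_natCard g))
    have hdvd := (Nat.minFac_dvd _).trans (_root_.orderOf_dvd_natCard (MulAut.conjNormal (H := A) g))
    rw [hcard] at hdvd
    have := Nat.le_of_dvd (Nat.sub_pos_of_lt hp.out.one_lt) hdvd
    have := hp.out.pos
    omega
  intro a ha
  rw [Subgroup.mem_center_iff]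
  intro g
  have h := MulAut.conjNormal_apply g (⟨a, ha⟩ : A)
  rw [htriv g, MulAut.one_apply] at h
  exact (eq_mul_inv_iff_mul_eq.1 h).symm

open scoped IsMulCommutative in
/-- `p`-nilpotency lifts along a quotient by a central subgroup of order `p`. -/
theorem PRegularClosed.of_quotient_of_le_center (A : Subgroup G) [A.Normal] (hA : Nat.card A = p)
    (hc : A ≤ Subgroup.center G) (h : PRegularClosed p (G ⧸ A)) : PRegularClosed p G := by
  set L : Subgroup G := h.regularSubgroup.comap (QuotientGroup.mk' A) with hL
  have hmem : ∀ x : G, p.Coprime (orderOf x) → x ∈ L := fun x hx =>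
    h.mem_regularSubgroup.2 (hx.coprime_dvd_right (orderOf_map_dvd (QuotientGroup.mk' A) x))
  set B : Subgroup L := A.subgroupOf L with hB
  have hAL : A ≤ L := fun a ha => by
    rw [hL, Subgroup.mem_comap, QuotientGroup.mk'_apply, (QuotientGroup.eq_one_iff a).2 ha]
    exact one_mem _
  have hBc : ∀ b ∈ B, ∀ x : L, x * b = b * x := fun b hb x =>
    Subtype.ext (Subgroup.mem_center_iff.1 (hc hb) x)
  have : IsMulCommutative B := ⟨⟨fun a b => Subtype.ext (hBc b b.2 a)⟩⟩
  have hindex : p.Coprime B.index := by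
    have h1 : B.index = Nat.card h.regularSubgroup := by
      have := Subgroup.relIndex_ker L (QuotientGroup.mk' A)
      rwa [QuotientGroup.ker_mk', Subgroup.map_comap_eq_self_of_surjective
        (QuotientGroup.mk'_surjective A)] at this
    rw [h1]
    exact h.coprime_card_regularSubgroup
  have hcardB : Nat.card B = p := by
    rw [← hA]
    exact Nat.card_congr (Subgroup.subgroupOfEquivOfLe hAL).toEquiv
  -- Transfer into the central subgroup `B` is the power map `x ↦ x ^ B.index`. It kills elements of
  -- order prime to `p`, as `B` has order `p`; hence also their products, whose orders then divide
  -- `B.index`, which is prime to `p`.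
  let φ : L →* B := MonoidHom.transfer (MonoidHom.id B)
  have hφ : ∀ x : L, (φ x : L) = x ^ B.index := fun x => by
    have := MonoidHom.transfer_eq_pow (MonoidHom.id B) x fun k g₀ hk =>
      mul_right_cancel ((hBc _ hk g₀).symm.trans (by group))
    exact congrArg Subtype.val this
  have hφ1 : ∀ x : L, p.Coprime (orderOf x) → φ x = 1 := fun x hx => by
    rw [← orderOf_eq_one_iff]
    refine Nat.Coprime.eq_one_of_dvd (m := p) (hx.symm.coprime_dvd_left (orderOf_map_dvd φ x)) ?_
    exact hcardB ▸ orderOf_dvd_natCard (φ x)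
  intro x y hx hy
  have h1 := hφ1 ⟨x, hmem x hx⟩ (by rwa [Subgroup.orderOf_mk])
  have h2 := hφ1 ⟨y, hmem y hy⟩ (by rwa [Subgroup.orderOf_mk])
  have h3 := hφ (⟨x, hmem x hx⟩ * ⟨y, hmem y hy⟩)
  rw [map_mul, h1, h2, mul_one] at h3
  exact hindex.coprime_dvd_right (orderOf_dvd_of_pow_eq_one (congrArg Subtype.val h3).symm)

/-- A supersolvable group is `p`-nilpotent for the smallest prime divisor `p` of its order. -/
theorem IsSupersolvable.pRegularClosed (hG : IsSupersolvable G)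
    (hmin : ∀ q : ℕ, q.Prime → q ∣ Nat.card G → p ≤ q) : PRegularClosed p G := by
  induction hn : Nat.card G using Nat.strong_induction_on generalizing G with
  | h n ih =>
  subst hn
  rcases subsingleton_or_nontrivial G with hs | hs
  · intro x y _ _
    rw [Subsingleton.elim (x * y) 1, orderOf_one]
    exact Nat.coprime_one_right p
  obtain ⟨A, hN, hA⟩ := hG.exists_normal_card_prime
  have hmul := A.card_eq_card_quotient_mul_card_subgroup
  have hquot : PRegularClosed p (G ⧸ A) := by
    refine ih _ ?_ (hG.of_surjective (QuotientGroup.mk'_surjective A))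
      (fun q hq hd => hmin q hq (hd.trans (Dvd.intro _ hmul.symm))) rfl
    rw [hmul]
    exact lt_mul_of_one_lt_right Nat.card_pos hA.one_lt
  by_cases hpA : Nat.card A = p
  · exact .of_quotient_of_le_center A hpA (A.le_center_of_card_eq_of_le hmin hpA) hquot
  · exact .of_quotient_of_coprime A ((Nat.coprime_primes hp.out hA).2 (Ne.symm hpA)) hquot

end Nilpotency

/-! ### The supersolvable residual in subgroups and quotients. -/

section Residual

variable {G G' : Type*} [Group G] [Group G']

/-- The defining family is closed under binary intersection, so by finiteness a minimal member is
the least one. -/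
theorem supersolvableResidual_mem [Finite G] :
    supersolvableResidual G ∈ {N : Subgroup G | ∃ _ : N.Normal, IsSupersolvable (G ⧸ N)} := by
  set S := {N : Subgroup G | ∃ _ : N.Normal, IsSupersolvable (G ⧸ N)} with hS
  have htop : (⊤ : Subgroup G) ∈ S := ⟨inferInstance, have := QuotientGroup.subsingleton_quotient_top (G := G)
      isSupersolvable_of_subsingleton⟩
  obtain ⟨N, hN⟩ := S.toFinite.exists_minimal ⟨⊤, htop⟩
  have hinf : ∀ M ∈ S, N ≤ M := by
    rintro M ⟨hM, hMs⟩
    obtain ⟨hN1, hNs⟩ := hN.1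
    exact (hN.2 ⟨inferInstance, hNs.quotient_inf hMs⟩ inf_le_left).trans inf_le_right
  have : supersolvableResidual G = N := le_antisymm (sInf_le hN.1) (le_sInf hinf)
  rw [this]
  exact hN.1

theorem isSupersolvable_of_supersolvableResidual_eq_bot [Finite G]
    (h : supersolvableResidual G = ⊥) : IsSupersolvable G := by
  obtain ⟨hN, hs⟩ := supersolvableResidual_mem (G := G)
  rw [isSupersolvable_quotient_iff, h] at hs
  exact isSupersolvable_iff_reflTransGen.2 hs

theorem map_supersolvableResidual_of_surjective [Finite G] {f : G →* G'}
    (hf : Function.Surjective f) :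
    (supersolvableResidual G).map f = supersolvableResidual G' := by
  apply le_antisymm
  · rw [Subgroup.map_le_iff_le_comap]
    refine fun a ha => Subgroup.mem_sInf.2 ?_
    rintro N ⟨hN, hs⟩
    refine Subgroup.mem_sInf.1 ha (N.comap f) ⟨hN.comap f, ?_⟩
    rw [isSupersolvable_quotient_iff] at hs ⊢
    exact hs.lift (Subgroup.comap f) fun _ _ => IsCyclicStep.comap hf
  · obtain ⟨hN, hs⟩ := supersolvableResidual_mem (G := G)
    have hN' := hN.map f hf
    refine sInf_le ⟨hN', ?_⟩
    rw [isSupersolvable_quotient_iff] at hs ⊢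
    have := hs.lift (Subgroup.map f) fun _ _ => IsCyclicStep.map hf
    rwa [Function.onFun, Subgroup.map_top_of_surjective f hf] at this

theorem Subgroup.map_supersolvableResidual_hom [Finite G] (f : G →* G') (T : Subgroup G) :
    T.supersolvableResidual.map f = (T.map f).supersolvableResidual := by
  rw [Subgroup.supersolvableResidual, Subgroup.supersolvableResidual,
    ← map_supersolvableResidual_of_surjective (f.subgroupMap_surjective T), Subgroup.map_map,
    Subgroup.map_map]
  rfl

theorem Subgroup.supersolvableResidual_le (T : Subgroup G) : T.supersolvableResidual ≤ T :=
  Subgroup.map_subtype_le _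

/-- The residual of a subgroup of `H` is the same computed in `H` or in `G`. This serves both the
normal subgroups of a minimal counterexample and the norm itself. -/
theorem supersolvableNorm_subgroup_eq_top [Finite G] {H : Subgroup G}
    (h : ∀ T ≤ H, H ≤ Subgroup.normalizer (T.supersolvableResidual : Set G)) :
    supersolvableNorm H = ⊤ := by
  rw [supersolvableNorm_eq_top_iff]
  intro T
  have hR := T.map_supersolvableResidual_hom H.subtype
  have hle := h _ (Subgroup.map_subtype_le T)
  rw [← hR] at hle
  have := Subgroup.normal_subgroupOf_of_le_normalizer hle
  rwa [Subgroup.subgroupOf, Subgroup.comap_map_eq_self_of_injective H.subtype_injective] at this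

theorem supersolvableNorm_quotient_eq_top [Finite G] (h : supersolvableNorm G = ⊤)
    (N : Subgroup G) [N.Normal] : supersolvableNorm (G ⧸ N) = ⊤ := by
  rw [supersolvableNorm_eq_top_iff] at h ⊢
  intro T
  have hs := QuotientGroup.mk'_surjective N
  rw [← Subgroup.map_comap_eq_self_of_surjective hs T, ← Subgroup.map_supersolvableResidual_hom]
  exact (h _).map _ hs

end Residual

/-! ### The minimal counterexample and the ascending series. -/

section Solvability

variable {G : Type u} [Group G] [Finite G]

theorem isSolvable_of_supersolvableNorm_eq_top (hG : supersolvableNorm G = ⊤) :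
    Group.IsSolvable G := by
  induction hn : Nat.card G using Nat.strong_induction_on generalizing G with
  | h n ih =>
  subst hn
  rcases subsingleton_or_nontrivial G with hs | hs
  · infer_instance
  by_contra hns
  have hres := supersolvableNorm_eq_top_iff.1 hG
  have hsimple : ∀ N : Subgroup G, N.Normal → N = ⊥ ∨ N = ⊤ := by
    intro N hN
    by_contra! hne
    have hmul := N.card_eq_card_quotient_mul_card_subgroup
    have h1 : Group.IsSolvable N := by
      refine ih _ ?_ (supersolvableNorm_subgroup_eq_top fun T _ => ?_) rfl
      · exact lt_of_le_of_ne N.card_le_card_group fun h => hne.2 (N.eq_top_of_card_eq h)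
      · have := hres T
        rw [Subgroup.normalizer_eq_top]
        exact le_top
    have h2 : Group.IsSolvable (G ⧸ N) := by
      refine ih _ ?_ (supersolvableNorm_quotient_eq_top hG N) rfl
      rw [hmul]
      exact lt_mul_of_one_lt_right Nat.card_pos ((Subgroup.one_lt_card_iff_ne_bot N).2 hne.1)
    exact hns ((Group.isSolvable_iff_subgroup_quotient N).2 ⟨h1, h2⟩)
  have hcomm : commutator G = ⊤ := by
    refine (hsimple _ inferInstance).resolve_left fun h => hns ⟨1, ?_⟩
    rw [derivedSeries_one, h]
  have hsuper : ∀ T : Subgroup G, T ≠ ⊤ → IsSupersolvable T := by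
    intro T hT
    apply isSupersolvable_of_supersolvableResidual_eq_bot
    have h := (hsimple _ (hres T)).resolve_right fun h =>
      hT (top_le_iff.1 (h ▸ T.supersolvableResidual_le))
    exact (Subgroup.map_eq_bot_iff_of_injective _ T.subtype_injective).1 h
  have hcard : Nat.card G ≠ 1 := Finite.one_lt_card.ne'
  have hp : Fact (Nat.card G).minFac.Prime := ⟨Nat.minFac_prime hcard⟩
  refine Sylow.commutator_ne_top (p := (Nat.card G).minFac) (fun D hD hbot => ?_)
    (Nat.minFac_dvd _) hcomm
  refine (hsuper _ fun htop => ?_).pRegularClosed fun q hq hd =>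
    Nat.minFac_le_of_dvd hq.two_le (hd.trans (Subgroup.card_subgroup_dvd_card _))
  -- If the normalizer were all of `G`, simplicity would make `G = D` a `p`-group, hence nilpotent
  -- and solvable.
  have hDtop := (hsimple D (Subgroup.normalizer_eq_top_iff.1 htop)).resolve_left hbot
  subst hDtop
  have := (hD.of_equiv Subgroup.topEquiv).isNilpotent
  exact hns inferInstance

theorem isSolvable_supersolvableNorm : Group.IsSolvable (supersolvableNorm G) :=
  isSolvable_of_supersolvableNorm_eq_top <| supersolvableNorm_subgroup_eq_top fun T _ _ hx =>
    mem_supersolvableNorm_iff.1 hx T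

theorem isSolvable_supersolvableNormSeries (i : ℕ) :
    Group.IsSolvable (supersolvableNormSeries G i) := by
  induction i with
  | zero => rw [supersolvableNormSeries_zero]; infer_instance
  | succ i ih =>
    rw [supersolvableNormSeries_succ]
    set N := supersolvableNormSeries G i
    have := isSolvable_supersolvableNorm (G := G ⧸ N)
    have hle : N ≤ (supersolvableNorm (G ⧸ N)).comap (QuotientGroup.mk' N) :=
      supersolvableNormSeries_monotone G i.le_succ
    refine Group.isSolvable_of_ker_le_range (Subgroup.inclusion hle)
      ((QuotientGroup.mk' N).subgroupComap (supersolvableNorm (G ⧸ N))) fun x hx => ?_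
    have hxN : (x : G) ∈ N :=
      (QuotientGroup.eq_one_iff (x : G)).1 (congrArg Subtype.val (MonoidHom.mem_ker.1 hx))
    exact ⟨⟨x, hxN⟩, rfl⟩

end Solvability

theorem theorem4p4 (G : Type*) [Group G] [Finite G] :
    (supersolvableNorm G = ⊤ → Group.IsSolvable G) ∧
      Group.IsSolvable (supersolvableNorm G) ∧ Group.IsSolvable (supersolvableHypernorm G) := by
  refine ⟨isSolvable_of_supersolvableNorm_eq_top, isSolvable_supersolvableNorm, ?_⟩
  obtain ⟨k, hk⟩ := supersolvableNormSeries_eventually_eq G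
  rw [← hk k le_rfl]
  exact isSolvable_supersolvableNormSeries k
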